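/- For disjoint graphs $G_1,G_2$, let $G_1+G_2$ be their disjoint union and $G_1\vee G_2$ their join (the disjoint union together with all edges between $V(G_1)$ and $V(G_2)$); $kK_1$ is the edgeless graph on $k$ vertices. For a finite simple graph $G$, $\delta(G)$ is its minimum degree and $\rho(G)$ is the largest eigenvalue of its adjacency matrix. $G$ is traceable (Hamiltonian) if it contains a path (cycle) through all its vertices. Put $$N_n^k=K_k\vee(K_{n-2k}+kK_1),\qquad \overline{N}_n^{\,k}=K_k\vee\bigl(K_{n-2k-1}+(k+1)K_1\bigr)$$ (here $\overline{N}_n^{\,k}$ is only a name; it is not the complement of $N_n^k$). **Theorem.** Let $k$ be an integer and let $G$ be a finite simple graph of order $n$. (1) If $\delta(G)\ge k\ge 0$, $n\ge\max\{6k+10,\,(k^2+7k+8)/2\}$ and $\rho(G)\ge\rho(\overline{N}_n^{\,k})$, then $G$ is traceable unless $G$ is isomorphic to $\overline{N}_n^{\,k}$, in which case $G$ is not traceable. (2) If $\delta(G)\ge k\ge 1$, $n\ge\max\{6k+5,\,(k^2+6k+4)/2\}$ and $\rho(G)\ge\rho(N_n^k)$, then $G$ is Hamiltonian unless $G$ is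 isomorphic to $N_n^k$, in which case $G$ is not Hamiltonian. -/

import Mathlib

namespace SimpleGraph

/-- The join of two graphs on disjoint vertex sets: their disjoint union together with all edges
between the two vertex sets. -/
def join {V W : Type*} (G : SimpleGraph V) (H : SimpleGraph W) : SimpleGraph (V ⊕ W) :=
  (G ⊕g H) ⊔ completeBipartiteGraph V W

/-- A graph is traceable if it contains a Hamilton path. -/
def IsTraceable {V : Type*} [DecidableEq V] (G : SimpleGraph V) : Prop :=
  ∃ (a b : V) (p : G.Walk a b), p.IsHamiltonian

open Classical in
/-- The spectral radius of a finite graph: the largest (real) eigenvalue of its adjacency matrix.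
The set of eigenvalues is finite, and nonempty as soon as the graph has a vertex, so that the
supremum is a maximum. -/
noncomputable def spectralRadius {V : Type*} [Fintype V] (G : SimpleGraph V) : ℝ :=
  sSup {μ : ℝ | Module.End.HasEigenvalue (Matrix.toLin' (G.adjMatrix ℝ)) μ}

/-- The graph `K_k ∨ (K_{n-2k} + k K_1)`, of order `n` when `2k ≤ n`. -/
def graphN (n k : ℕ) : SimpleGraph (Fin k ⊕ (Fin (n - 2 * k) ⊕ Fin k)) :=
  join (completeGraph (Fin k))
    (completeGraph (Fin (n - 2 * k)) ⊕g emptyGraph (Fin k))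

/-- The graph `K_k ∨ (K_{n-2k-1} + (k+1) K_1)`, of order `n` when `2k + 1 ≤ n`. -/
def graphNBar (n k : ℕ) : SimpleGraph (Fin k ⊕ (Fin (n - 2 * k - 1) ⊕ Fin (k + 1))) :=
  join (completeGraph (Fin k))
    (completeGraph (Fin (n - 2 * k - 1)) ⊕g emptyGraph (Fin (k + 1)))

end SimpleGraph

/-!
The proof combines degree-sum closure with a spectral comparison. The two parts run in parallel,
with `s = 0` for Hamilton cycles and `s = 1` for Hamilton paths; write `r = k + s` and
`c = n - k - s`, so that the extremal graph is `K_k ∨ (K_{c-k} + r K_1)`.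

Suppose `G` has no Hamilton cycle (path) and let `H ≥ G` be edge-maximal with this property. By the
Bondy–Chvátal exchange (`IsCycleSeq.of_sup_edge`; for paths it is applied to the cone over the
graph), nonadjacent vertices of `H` have degree sum less than `n - s`. The hypothesis on the
spectral radius forces many edges, by the Hong–Shu–Fang bound (`sq_sub_le_of_eigenvector`), and a
dense graph with small degree sums of nonadjacent pairs contains a clique `C` on `c` vertices, while
the `r` remaining vertices all have degree `k` and share the same neighbours `F` in `C`
(`exists_isCliqueSplit`).

It remains to see that `|F| = k` and `G = H`. Let `l = t + c - 1` be the spectral radius of the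
extremal graph, where `t > 0` is a root of the cubic of `exists_root_of_quotient_equation`. The
vector equal to `1` on `F`, to `f / (t + f)` on `C \ F` and to `f / (l - k + f)` outside `C`, with
`f = |F|`, satisfies `A_H w ≤ l w`, strictly on `F` when `f < k` (`quotient_row_lt`). Rigidity in the
Collatz–Wielandt bound (`eigenvector_rigidity`) together with the vertices of `F`, which dominate
`H`, then gives `f = k` and `G = H` (`IsCliqueSplit.eq_and_card_eq`). The cases `F = ∅` and `k = 0`
use the constant vector instead.

Conversely, in the extremal graph the independent set of size `r` has all its neighbours in a set of
size `k`, which is incompatible with a Hamilton cycle (path) through the remaining clique vertices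
(`IsCycleSeq.mem_of_card_le`).
-/

namespace SimpleGraph

/-! ### Adjacency eigenvalues and the Collatz–Wielandt comparison -/

section Spectrum

variable {V : Type*} [Fintype V]

theorem sum_neighborFinset_eq (G : SimpleGraph V) [DecidableRel G.Adj] (x : V → ℝ) (i : V) :
    ∑ j ∈ G.neighborFinset i, x j = ∑ j, if G.Adj i j then x j else 0 := by
  rw [← Finset.sum_filter, neighborFinset_eq_filter]

theorem sum_mul_sum_neighborFinset_comm (G : SimpleGraph V) [DecidableRel G.Adj] (w x : V → ℝ) :
    ∑ i, w i * ∑ j ∈ G.neighborFinset i, x j = ∑ i, x i * ∑ j ∈ G.neighborFinset i, w j := by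
  simp only [sum_neighborFinset_eq, Finset.mul_sum]
  rw [Finset.sum_comm]
  refine Finset.sum_congr rfl fun i _ => Finset.sum_congr rfl fun j _ => ?_
  simp only [G.adj_comm j i, mul_ite, mul_zero, mul_comm]

theorem hasEigenvalue_adjMatrix_iff [DecidableEq V] (G : SimpleGraph V) [DecidableRel G.Adj]
    (μ : ℝ) :
    Module.End.HasEigenvalue (Matrix.toLin' (G.adjMatrix ℝ)) μ ↔
      ∃ u : V → ℝ, u ≠ 0 ∧ ∀ i, ∑ j ∈ G.neighborFinset i, u j = μ * u i := by
  constructor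
  · intro h
    obtain ⟨u, hu⟩ := h.exists_hasEigenvector
    refine ⟨u, hu.2, fun i => ?_⟩
    have := congrFun hu.apply_eq_smul i
    simpa [Matrix.toLin'_apply, adjMatrix_mulVec_apply] using this
  · rintro ⟨u, hu, h⟩
    refine Module.End.hasEigenvalue_of_hasEigenvector (x := u) ?_
    rw [Module.End.hasEigenvector_iff]
    refine ⟨Module.End.mem_eigenspace_iff.mpr ?_, hu⟩
    ext i
    simpa [Matrix.toLin'_apply, adjMatrix_mulVec_apply] using h i

theorem le_spectralRadius (G : SimpleGraph V) [DecidableRel G.Adj] {μ : ℝ} {u : V → ℝ}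
    (hu : u ≠ 0) (h : ∀ i, ∑ j ∈ G.neighborFinset i, u j = μ * u i) :
    μ ≤ G.spectralRadius := by
  classical
  unfold spectralRadius
  refine le_csSup (Module.End.finite_hasEigenvalue _).bddAbove ?_
  rw [Set.mem_ofPred_eq, hasEigenvalue_adjMatrix_iff]
  exact ⟨u, hu, fun i => by convert h i⟩

/-- The supremum defining the spectral radius is attained. -/
theorem exists_eigenvector_spectralRadius [Nonempty V] (G : SimpleGraph V) [DecidableRel G.Adj] :
    ∃ u : V → ℝ, u ≠ 0 ∧ ∀ i, ∑ j ∈ G.neighborFinset i, u j = G.spectralRadius * u i := by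
  classical
  have hA : (G.adjMatrix ℝ).IsHermitian := by
    rw [Matrix.IsHermitian, Matrix.conjTranspose_eq_transpose_of_trivial, transpose_adjMatrix]
  have hne : {μ : ℝ | Module.End.HasEigenvalue (Matrix.toLin' (G.adjMatrix ℝ)) μ}.Nonempty := by
    obtain ⟨j⟩ := ‹Nonempty V›
    refine ⟨hA.eigenvalues j, Module.End.hasEigenvalue_iff_mem_spectrum.mpr ?_⟩
    rw [Matrix.spectrum_toLin']
    exact hA.eigenvalues_mem_spectrum_real j
  have := hne.csSup_mem (Module.End.finite_hasEigenvalue _)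
  rw [Set.mem_ofPred_eq, hasEigenvalue_adjMatrix_iff] at this
  obtain ⟨u, hu, h⟩ := this
  refine ⟨u, hu, fun i => ?_⟩
  rw [h i]
  unfold spectralRadius
  congr!

theorem mul_abs_le_sum_neighborFinset (G : SimpleGraph V) [DecidableRel G.Adj] {μ : ℝ}
    (hμ : 0 ≤ μ) {u : V → ℝ} (h : ∀ i, ∑ j ∈ G.neighborFinset i, u j = μ * u i) (i : V) :
    μ * |u i| ≤ ∑ j ∈ G.neighborFinset i, |u j| := by
  calc μ * |u i| = |∑ j ∈ G.neighborFinset i, u j| := by rw [h i, abs_mul, abs_of_nonneg hμ]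
    _ ≤ _ := Finset.abs_sum_le_sum_abs _ _

/-- The Hong–Shu–Fang bound on nonnegative adjacency eigenvalues of a graph with minimum degree at
least `k`, cleared of its square root. It comes from evaluating `1ᵀ (A² - (k - 1) A) |u|`
from both sides, where `u` is an eigenvector. -/
theorem sq_sub_le_of_eigenvector (G : SimpleGraph V) [DecidableRel G.Adj] {k : ℕ}
    (hk : ∀ v, k ≤ G.degree v) {μ : ℝ} (hμ : 0 ≤ μ) {u : V → ℝ} (hu : u ≠ 0)
    (h : ∀ i, ∑ j ∈ G.neighborFinset i, u j = μ * u i) :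
    μ ^ 2 - (k - 1) * μ ≤ ∑ v, (G.degree v : ℝ) - k * (Fintype.card V - 1) := by
  classical
  set x : V → ℝ := fun i => |u i| with hx
  have hx0 : ∀ i, 0 ≤ x i := fun i => abs_nonneg _
  have hAx := mul_abs_le_sum_neighborFinset G hμ h
  have hpos : 0 < ∑ i, x i := by
    obtain ⟨i, hi⟩ := Function.ne_iff.mp hu
    exact Finset.sum_pos' (fun i _ => hx0 i) ⟨i, Finset.mem_univ _, abs_pos.mpr hi⟩
  set D : V → ℝ := fun i => (G.degree i : ℝ) with hD
  have hdeg : ∀ i, ∑ j ∈ G.neighborFinset i, (1 : ℝ) = D i := by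
    intro i; simp [hD]
  have hrow : ∀ i, ∑ j ∈ G.neighborFinset i, D j - (k - 1) * D i ≤
      ∑ v, D v - k * (Fintype.card V - 1) := by
    intro i
    have hi : i ∉ G.neighborFinset i := by simp
    have hsplit : ∑ v, D v = D i + ∑ j ∈ G.neighborFinset i, D j +
        ∑ j ∈ (insert i (G.neighborFinset i))ᶜ, D j := by
      rw [← Finset.sum_add_sum_compl (insert i (G.neighborFinset i)), Finset.sum_insert hi]
    have hcard : ((insert i (G.neighborFinset i))ᶜ.card : ℝ) = Fintype.card V - 1 - D i := by
      have h1 := Finset.card_add_card_compl (insert i (G.neighborFinset i))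
      rw [Finset.card_insert_of_notMem hi, card_neighborFinset_eq_degree] at h1
      have h2 : (G.degree i : ℝ) + 1 + ((insert i (G.neighborFinset i))ᶜ.card : ℝ)
        = Fintype.card V := by exact_mod_cast h1
      simp only [hD]; linarith
    have hrest : (k : ℝ) * (Fintype.card V - 1 - D i) ≤
        ∑ j ∈ (insert i (G.neighborFinset i))ᶜ, D j := by
      rw [← hcard]
      have := Finset.card_nsmul_le_sum (insert i (G.neighborFinset i))ᶜ D (k : ℝ)
        (fun j _ => by simpa [hD] using hk j)
      simpa [mul_comm] using this
    rw [hsplit]; linarith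
  have hcomm := sum_mul_sum_neighborFinset_comm G D x
  have hcomm1 := sum_mul_sum_neighborFinset_comm G (fun _ => 1) x
  simp only [hdeg, one_mul] at hcomm1
  -- the lower estimate uses `A |u| ≥ μ |u|` together with the nonnegative weights `d - (k - 1)`
  have hlow : μ * ∑ i, (D i - (k - 1)) * x i ≤
      ∑ i, (D i - (k - 1)) * ∑ j ∈ G.neighborFinset i, x j := by
    rw [Finset.mul_sum]
    refine Finset.sum_le_sum fun i _ => ?_
    have hDk : (k : ℝ) ≤ D i := by simpa [hD] using hk i
    have := mul_le_mul_of_nonneg_left (hAx i) (by linarith : (0 : ℝ) ≤ D i - (k - 1))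
    linarith
  have hup : ∑ i, (D i - (k - 1)) * ∑ j ∈ G.neighborFinset i, x j ≤
      (∑ v, D v - k * (Fintype.card V - 1)) * ∑ i, x i := by
    calc _ = ∑ i, x i * (∑ j ∈ G.neighborFinset i, D j - (k - 1) * D i) := by
          simp only [sub_mul, mul_sub, Finset.sum_sub_distrib, ← Finset.mul_sum]
          rw [hcomm, hcomm1, Finset.mul_sum]
          congr 1
          · simp only [one_mul, Finset.mul_sum]
            simp only [← Finset.sum_sub_distrib]
            exact Finset.sum_congr rfl fun i _ => by ring
      _ ≤ ∑ i, x i * (∑ v, D v - k * (Fintype.card V - 1)) :=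
          Finset.sum_le_sum fun i _ => mul_le_mul_of_nonneg_left (hrow i) (hx0 i)
      _ = _ := by rw [← Finset.sum_mul, mul_comm]
  have hlow2 : (μ ^ 2 - (k - 1) * μ) * ∑ i, x i ≤ μ * ∑ i, (D i - (k - 1)) * x i := by
    have h1 : μ * ∑ i, x i ≤ ∑ i, x i * D i := by
      rw [← hcomm1, Finset.mul_sum]
      exact Finset.sum_le_sum fun i _ => hAx i
    have h2 : ∑ i, (D i - (k - 1)) * x i = ∑ i, x i * D i - (k - 1) * ∑ i, x i := by
      rw [Finset.mul_sum, ← Finset.sum_sub_distrib]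
      exact Finset.sum_congr rfl fun i _ => by ring
    rw [h2]
    nlinarith [mul_le_mul_of_nonneg_left h1 hμ]
  exact le_of_mul_le_mul_right (hlow2.trans (hlow.trans hup)) hpos

/-- Rigidity in the Collatz–Wielandt bound: if `w > 0` satisfies `A_H w ≤ l w` and a subgraph `G`
of `H` has an eigenvalue `μ ≥ l` with eigenvector `u`, then `|u|` is an eigenvector of
both `G` and `H` for `l`, and `A_H w = l w` wherever `u` does not vanish. -/
theorem eigenvector_rigidity {G H : SimpleGraph V} [DecidableRel G.Adj] [DecidableRel H.Adj]
    (hGH : G ≤ H) {w : V → ℝ} (hw : ∀ i, 0 < w i) {l : ℝ} (hl : 0 ≤ l)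
    (hH : ∀ i, ∑ j ∈ H.neighborFinset i, w j ≤ l * w i) {μ : ℝ} (hlμ : l ≤ μ)
    {u : V → ℝ} (h : ∀ i, ∑ j ∈ G.neighborFinset i, u j = μ * u i) :
    (∀ i, ∑ j ∈ G.neighborFinset i, |u j| = l * |u i|) ∧
    (∀ i, ∑ j ∈ H.neighborFinset i, |u j| = l * |u i|) ∧
    (∀ i, u i ≠ 0 → ∑ j ∈ H.neighborFinset i, w j = l * w i) := by
  have hG1 : ∀ i, l * |u i| ≤ ∑ j ∈ G.neighborFinset i, |u j| := fun i =>
    (mul_le_mul_of_nonneg_right hlμ (abs_nonneg _)).trans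
      (mul_abs_le_sum_neighborFinset G (hl.trans hlμ) h i)
  have hGH1 : ∀ i, ∑ j ∈ G.neighborFinset i, |u j| ≤ ∑ j ∈ H.neighborFinset i, |u j| := by
    intro i
    refine Finset.sum_le_sum_of_subset_of_nonneg ?_ fun _ _ _ => abs_nonneg _
    intro j; simpa using fun hj => hGH hj
  have hcomm := sum_mul_sum_neighborFinset_comm H w (fun i => |u i|)
  have hA : ∀ i ∈ Finset.univ, 0 ≤ w i * (∑ j ∈ H.neighborFinset i, |u j| - l * |u i|) :=
    fun i _ => mul_nonneg (hw i).le (sub_nonneg.mpr ((hG1 i).trans (hGH1 i)))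
  have hB : ∀ i ∈ Finset.univ, 0 ≤ |u i| * (l * w i - ∑ j ∈ H.neighborFinset i, w j) :=
    fun i _ => mul_nonneg (abs_nonneg _) (sub_nonneg.mpr (hH i))
  have hsum : ∑ i, w i * (∑ j ∈ H.neighborFinset i, |u j| - l * |u i|) =
      - ∑ i, |u i| * (l * w i - ∑ j ∈ H.neighborFinset i, w j) := by
    simp only [mul_sub, Finset.sum_sub_distrib]
    rw [hcomm, neg_sub]
    congr 1
    exact Finset.sum_congr rfl fun i _ => by ring
  have hA0 : ∑ i, w i * (∑ j ∈ H.neighborFinset i, |u j| - l * |u i|) = 0 :=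
    le_antisymm (hsum ▸ neg_nonpos.mpr (Finset.sum_nonneg hB)) (Finset.sum_nonneg hA)
  have hB0 : ∑ i, |u i| * (l * w i - ∑ j ∈ H.neighborFinset i, w j) = 0 := by
    rw [hA0] at hsum; linarith
  have hH1 : ∀ i, ∑ j ∈ H.neighborFinset i, |u j| = l * |u i| := fun i => by
    have := (Finset.sum_eq_zero_iff_of_nonneg hA).mp hA0 i (Finset.mem_univ i)
    have := (mul_eq_zero.mp this).resolve_left (hw i).ne'
    linarith
  refine ⟨fun i => le_antisymm ((hGH1 i).trans (hH1 i).le) (hG1 i), hH1, fun i hi => ?_⟩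
  have := (Finset.sum_eq_zero_iff_of_nonneg hB).mp hB0 i (Finset.mem_univ i)
  have := (mul_eq_zero.mp this).resolve_left (abs_ne_zero.mpr hi)
  linarith

/-- An edge of `H` meeting the support of a common `|u|` as in `eigenvector_rigidity` lies in
`G`. -/
theorem adj_of_sum_neighborFinset_eq {G H : SimpleGraph V} [DecidableRel G.Adj]
    [DecidableRel H.Adj] (hGH : G ≤ H) {x : V → ℝ} (hx : ∀ i, 0 ≤ x i) {i j : V}
    (h : ∑ j ∈ G.neighborFinset i, x j = ∑ j ∈ H.neighborFinset i, x j)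
    (hj : 0 < x j) (hij : H.Adj i j) : G.Adj i j := by
  by_contra hG
  refine h.not_lt (Finset.sum_lt_sum_of_subset (i := j) ?_ (by simpa) (by simpa) hj
    fun _ _ _ => hx _)
  intro j; simpa using fun hj => hGH hj

/-- Strict monotonicity of the spectral radius in the presence of a vertex `d` of `H` adjacent to
all others. -/
theorem eq_of_dominating {G H : SimpleGraph V} [DecidableRel G.Adj] [DecidableRel H.Adj]
    (hGH : G ≤ H) {w : V → ℝ} (hw : ∀ i, 0 < w i) {l : ℝ} (hl : 0 < l)
    (hH : ∀ i, ∑ j ∈ H.neighborFinset i, w j ≤ l * w i) (hlμ : l ≤ G.spectralRadius)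
    {d : V} (hd : ∀ v, v ≠ d → H.Adj d v) :
    G = H ∧ ∀ i, ∑ j ∈ H.neighborFinset i, w j = l * w i := by
  have : Nonempty V := ⟨d⟩
  obtain ⟨u, hu, h⟩ := G.exists_eigenvector_spectralRadius
  obtain ⟨h1, h2, h3⟩ := eigenvector_rigidity hGH hw hl.le hH hlμ h
  have hd0 : 0 < |u d| := by
    obtain ⟨v, hv⟩ := Function.ne_iff.mp hu
    have hv : 0 < |u v| := abs_pos.mpr hv
    rcases eq_or_ne v d with rfl | hvd
    · exact hv
    · have : 0 < l * |u d| := by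
        rw [← h2 d]
        exact Finset.sum_pos' (fun _ _ => abs_nonneg _) ⟨v, by simpa using hd v hvd, hv⟩
      exact (mul_pos_iff_of_pos_left hl).mp this
  have hpos : ∀ v, 0 < |u v| := by
    intro v
    rcases eq_or_ne v d with rfl | hvd
    · exact hd0
    · have : 0 < l * |u v| := by
        rw [← h2 v]
        exact Finset.sum_pos' (fun _ _ => abs_nonneg _) ⟨d, by simpa using (hd v hvd).symm, hd0⟩
      exact (mul_pos_iff_of_pos_left hl).mp this
  refine ⟨le_antisymm hGH fun i j hij => ?_, fun i => h3 i (abs_pos.mp (hpos i))⟩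
  exact adj_of_sum_neighborFinset_eq hGH (fun _ => abs_nonneg _) ((h1 i).trans (h2 i).symm)
    (hpos j) hij

end Spectrum

/-! ### Spectral comparison with the extremal graph -/

section Comparison

/-- The graph `K_a ∨ (K_b + r K_1)`, of which `graphN` and `graphNBar` are instances. -/
def joinCliqueIndep (a b r : ℕ) : SimpleGraph (Fin a ⊕ (Fin b ⊕ Fin r)) :=
  join (completeGraph (Fin a)) (completeGraph (Fin b) ⊕g emptyGraph (Fin r))

/-- For `l = t + c - 1` this cubic equation says that `l` is the spectral radius of
`K_k ∨ (K_{c-k} + r K_1)`. -/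
theorem exists_root_of_quotient_equation {k r c : ℝ} (hk : 1 ≤ k) (hr : 1 ≤ r) (hc : 1 ≤ c) :
    ∃ t : ℝ, 0 < t ∧ r * k * (k + t) = t * (t + c) * (t + c - 1) := by
  set g : ℝ → ℝ := fun t => t * (t + c) * (t + c - 1) - r * k * (k + t) with hg
  have hT1 : k ≤ r * k := by nlinarith
  have hT : 1 ≤ r * k := hk.trans hT1
  have h0 : g 0 ≤ 0 := by
    have : 0 ≤ r * k * k := by positivity
    simp only [hg]; linarith
  have h1 : 0 ≤ g (r * k) := by
    simp only [hg]
    set T := r * k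
    have a1 : (T + 1) * T ≤ (T + c) * (T + c - 1) := by nlinarith
    have a2 : k + T ≤ (T + 1) * T := by nlinarith
    have := mul_le_mul_of_nonneg_left (a2.trans a1) (by linarith : 0 ≤ T)
    linarith
  have hcont : ContinuousOn g (Set.Icc 0 (r * k)) := by
    simp only [hg]; fun_prop
  obtain ⟨t, ht, hgt⟩ := intermediate_value_Icc (by linarith : (0 : ℝ) ≤ r * k) hcont ⟨h0, h1⟩
  refine ⟨t, lt_of_le_of_ne ht.1 ?_, ?_⟩
  · rintro rfl
    have : 0 < r * k * k := by positivity
    simp only [hg] at hgt; linarith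
  · simp only [hg] at hgt; linarith

theorem add_sub_one_le_spectralRadius_joinCliqueIndep {k b r : ℕ} (hk : 1 ≤ k) {t : ℝ}
    (ht : 0 < t) (h : (r : ℝ) * k * (k + t) = t * (t + (k + b)) * (t + (k + b) - 1)) :
    t + (k + b) - 1 ≤ (joinCliqueIndep k b r).spectralRadius := by
  classical
  have hk' : (1 : ℝ) ≤ k := by exact_mod_cast hk
  have hb : (0 : ℝ) ≤ b := by positivity
  set l : ℝ := t + (k + b) - 1 with hl
  have hl0 : 0 < l := by rw [hl]; linarith
  refine le_spectralRadius _
    (u := Sum.elim (fun _ => 1) (Sum.elim (fun _ => k / (t + k)) (fun _ => k / l))) ?_ ?_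
  · intro hu
    simpa using congrFun hu (Sum.inl ⟨0, hk⟩)
  · intro i
    rw [sum_neighborFinset_eq, Fintype.sum_sum_type, Fintype.sum_sum_type]
    rcases i with i | i | i <;>
      simp [joinCliqueIndep, join, completeGraph, emptyGraph, Finset.sum_ite,
        Finset.filter_ne, Finset.card_erase_of_mem]
    · rw [Nat.cast_sub hk]
      field_simp
      push_cast
      have e : (b : ℝ) = l + 1 - t - k := by rw [hl]; ring
      have h' : (r : ℝ) * k * (k + t) = t * (l + 1) * l := by rw [h, hl]; ring
      rw [e]
      linear_combination h'
    · rw [Nat.cast_sub (by have := i.pos; omega)]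
      field_simp
      push_cast
      rw [hl]; ring
    · field_simp

theorem le_spectralRadius_joinCliqueIndep_zero {b r : ℕ} (hb : 1 ≤ b) :
    (b : ℝ) - 1 ≤ (joinCliqueIndep 0 b r).spectralRadius := by
  classical
  refine le_spectralRadius _ (u := Sum.elim (fun _ => 1) (Sum.elim (fun _ => 1) (fun _ => 0))) ?_ ?_
  · intro hu
    simpa using congrFun hu (Sum.inr (Sum.inl ⟨0, hb⟩))
  · intro i
    rw [sum_neighborFinset_eq, Fintype.sum_sum_type, Fintype.sum_sum_type]
    rcases i with i | i | i
    · exact i.elim0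
    · simp [joinCliqueIndep, join, completeGraph, emptyGraph, Finset.sum_ite,
        Finset.filter_ne, Finset.card_erase_of_mem]
      rw [Nat.cast_sub hb]; simp
    · simp [joinCliqueIndep, join, completeGraph, emptyGraph]

/-- The row sum at a vertex of the inner clique `F`, with `f` vertices, compared with the case
`f = k` in which it equals `l`. -/
theorem quotient_row_lt {f k r c t l : ℝ} (hf : 0 < f) (hfk : f < k) (hr : 0 < r) (hkl : k < l)
    (ht : 0 < t) (hl : l = t + c - 1) (h : r * k * (k + t) = t * (l + 1) * l) :
    f - 1 + (c - f) * (f / (t + f)) + r * (f / (l - k + f)) < l := by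
  have hl0 : 0 < l := by linarith
  have h1 : f - 1 + (c - f) * (f / (t + f)) = l - t * (l + 1) / (t + f) := by
    field_simp
    rw [hl]; ring
  have h2 : r * (f / (l - k + f)) < t * (l + 1) / (t + f) := by
    have e : t * (l + 1) = r * k * (k + t) / l := by field_simp; linarith
    rw [e, mul_div_assoc', div_div, div_lt_div_iff₀ (by linarith) (by positivity)]
    have a1 : f * l ≤ k * (l - k + f) := by nlinarith
    have a2 : f * l * (t + f) < k * (l - k + f) * (k + t) := by
      have : 0 < f * l := by positivity
      calc f * l * (t + f) < f * l * (k + t) := by nlinarith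
        _ ≤ _ := mul_le_mul_of_nonneg_right a1 (by linarith)
    nlinarith [mul_lt_mul_of_pos_left a2 hr]
  linarith

variable {V : Type*} [Fintype V] [DecidableEq V]

/-- `C` is a clique of `H` and every vertex outside `C` has degree `k`, its neighbours in `C`
being exactly the vertices of `F ⊆ C`. -/
structure IsCliqueSplit (H : SimpleGraph V) [DecidableRel H.Adj] (k : ℕ) (C F : Finset V) :
    Prop where
  isClique : H.IsClique (C : Set V)
  subset : F ⊆ C
  adj_iff : ∀ v, v ∉ C → ∀ u ∈ C, (H.Adj v u ↔ u ∈ F)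
  degree_eq : ∀ v, v ∉ C → H.degree v = k

namespace IsCliqueSplit

variable {H : SimpleGraph V} [DecidableRel H.Adj] {k : ℕ} {C F : Finset V}

theorem neighborFinset_of_notMem (h : H.IsCliqueSplit k C F) {v : V} (hv : v ∈ C) (hvF : v ∉ F) :
    H.neighborFinset v = C.erase v := by
  ext u
  rw [mem_neighborFinset, Finset.mem_erase]
  constructor
  · refine fun huv => ⟨huv.ne', ?_⟩
    by_contra hu
    exact hvF ((h.adj_iff u hu v hv).mp huv.symm)
  · exact fun hu => h.isClique hv hu.2 hu.1.symm

theorem neighborFinset_of_mem (h : H.IsCliqueSplit k C F) {v : V} (hvF : v ∈ F) :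
    H.neighborFinset v = C.erase v ∪ Cᶜ := by
  ext u
  rw [mem_neighborFinset, Finset.mem_union, Finset.mem_erase, Finset.mem_compl]
  constructor
  · intro huv
    by_cases hu : u ∈ C
    · exact Or.inl ⟨huv.ne', hu⟩
    · exact Or.inr hu
  · rintro (hu | hu)
    · exact h.isClique (h.subset hvF) hu.2 hu.1.symm
    · exact ((h.adj_iff u hu v (h.subset hvF)).mpr hvF).symm

theorem neighborFinset_of_notMem_clique (h : H.IsCliqueSplit k C F) {v : V} (hv : v ∉ C) :
    H.neighborFinset v = F ∪ H.neighborFinset v \ C := by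
  ext u
  rw [mem_neighborFinset, Finset.mem_union, Finset.mem_sdiff, mem_neighborFinset]
  by_cases hu : u ∈ C
  · simp [h.adj_iff v hv u hu, hu]
  · have hF : u ∉ F := fun hF => hu (h.subset hF)
    simp [hu, hF]

theorem disjoint_sdiff (h : H.IsCliqueSplit k C F) (v : V) :
    Disjoint F (H.neighborFinset v \ C) :=
  Finset.disjoint_left.mpr fun _ hu hu' => (Finset.mem_sdiff.mp hu').2 (h.subset hu)

theorem card_add_card_sdiff (h : H.IsCliqueSplit k C F) {v : V} (hv : v ∉ C) :
    F.card + (H.neighborFinset v \ C).card = k := by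
  rw [← h.degree_eq v hv, ← card_neighborFinset_eq_degree,
    ← Finset.card_union_of_disjoint (h.disjoint_sdiff v), ← h.neighborFinset_of_notMem_clique hv]

/-- The vector equal to `1` on `F`, to `y` on `C \ F` and to `z` outside `C`. -/
def weight (C F : Finset V) (y z : ℝ) (v : V) : ℝ := if v ∈ F then 1 else if v ∈ C then y else z

theorem sum_weight_clique (h : H.IsCliqueSplit k C F) (y z : ℝ) :
    ∑ v ∈ C, weight C F y z v = F.card + (C.card - F.card) * y := by
  rw [← Finset.sum_sdiff h.subset]
  have h1 : ∑ v ∈ C \ F, weight C F y z v = ∑ v ∈ C \ F, y :=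
    Finset.sum_congr rfl fun v hv => by
      obtain ⟨h1, h2⟩ := Finset.mem_sdiff.mp hv
      simp [weight, h1, h2]
  have h2 : ∑ v ∈ F, weight C F y z v = ∑ v ∈ F, (1 : ℝ) :=
    Finset.sum_congr rfl fun v hv => by simp [weight, hv]
  rw [h1, h2, Finset.sum_const, Finset.sum_const, nsmul_eq_mul, nsmul_eq_mul,
    Finset.card_sdiff_of_subset h.subset, Nat.cast_sub (Finset.card_le_card h.subset)]
  ring

theorem sum_weight_of_disjoint (h : H.IsCliqueSplit k C F) (y z : ℝ) {S : Finset V}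
    (hS : ∀ v ∈ S, v ∉ C) : ∑ v ∈ S, weight C F y z v = S.card * z := by
  rw [Finset.sum_congr rfl (g := fun _ => z) fun v hv => ?_]
  · simp
  · have hF : v ∉ F := fun hF => hS v hv (h.subset hF)
    simp [weight, hS v hv, hF]

theorem row_of_notMem (h : H.IsCliqueSplit k C F) (y z : ℝ) {v : V} (hv : v ∈ C) (hvF : v ∉ F) :
    ∑ u ∈ H.neighborFinset v, weight C F y z u = F.card + (C.card - F.card) * y - y := by
  rw [h.neighborFinset_of_notMem hv hvF, Finset.sum_erase_eq_sub hv, h.sum_weight_clique]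
  simp [weight, hv, hvF]

theorem row_of_mem (h : H.IsCliqueSplit k C F) (y z : ℝ) {v : V} (hvF : v ∈ F) :
    ∑ u ∈ H.neighborFinset v, weight C F y z u =
      F.card + (C.card - F.card) * y - 1 + Cᶜ.card * z := by
  rw [h.neighborFinset_of_mem hvF, Finset.sum_union, Finset.sum_erase_eq_sub (h.subset hvF),
    h.sum_weight_clique, h.sum_weight_of_disjoint y z (S := Cᶜ) (by simp)]
  · simp [weight, hvF]
  · exact Finset.disjoint_left.mpr fun u hu hu' =>
      Finset.mem_compl.mp hu' (Finset.mem_of_mem_erase hu)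

theorem row_of_notMem_clique (h : H.IsCliqueSplit k C F) (y z : ℝ) {v : V} (hv : v ∉ C) :
    ∑ u ∈ H.neighborFinset v, weight C F y z u = F.card + (k - F.card) * z := by
  rw [h.neighborFinset_of_notMem_clique hv, Finset.sum_union (h.disjoint_sdiff v),
    h.sum_weight_of_disjoint y z (S := H.neighborFinset v \ C) (by simp)]
  have h2 : ∑ v ∈ F, weight C F y z v = ∑ v ∈ F, (1 : ℝ) :=
    Finset.sum_congr rfl fun v hv => by simp [weight, hv]
  have := h.card_add_card_sdiff hv
  have h3 : ((F.card : ℝ) + ((H.neighborFinset v \ C).card : ℝ)) = k := by exact_mod_cast this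
  rw [h2, ← h3]; simp

/-- If `F` is nonempty, a subgraph of `H` whose spectral radius reaches that of
`K_k ∨ (K_{c-k} + r K_1)` is `H` itself, and `F` has `k` vertices. -/
theorem eq_and_card_eq (h : H.IsCliqueSplit k C F) {G : SimpleGraph V} [DecidableRel G.Adj]
    (hGH : G ≤ H) (hF : F.Nonempty) (hR : Cᶜ.Nonempty) (hkC : k < C.card) {t : ℝ} (ht : 0 < t)
    (hroot : (Cᶜ.card : ℝ) * k * (k + t) = t * (t + C.card) * (t + C.card - 1))
    (hρ : t + C.card - 1 ≤ G.spectralRadius) : G = H ∧ F.card = k := by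
  obtain ⟨v₀, hv₀⟩ := hR
  have hv₀ := Finset.mem_compl.mp hv₀
  have hFk : F.card ≤ k := by have := h.card_add_card_sdiff hv₀; omega
  obtain ⟨d, hd⟩ := hF
  have hf : (0 : ℝ) < F.card := by exact_mod_cast Finset.card_pos.mpr ⟨d, hd⟩
  have hr : (0 : ℝ) < Cᶜ.card := by
    exact_mod_cast Finset.card_pos.mpr ⟨v₀, Finset.mem_compl.mpr hv₀⟩
  have hFk' : (F.card : ℝ) ≤ k := by exact_mod_cast hFk
  have hkC' : (k : ℝ) + 1 ≤ C.card := by exact_mod_cast hkC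
  set f : ℝ := (F.card : ℝ)
  set c : ℝ := (C.card : ℝ)
  set r : ℝ := (Cᶜ.card : ℝ)
  set l : ℝ := t + c - 1 with hl
  have hkl : (k : ℝ) < l := by rw [hl]; linarith
  have hroot' : r * k * (k + t) = t * (l + 1) * l := by rw [hroot, hl]; ring
  set w := weight C F (f / (t + f)) (f / (l - k + f)) with hw
  have hden : 0 < l - k + f := by linarith
  have hrowF : f + (c - f) * (f / (t + f)) - 1 + r * (f / (l - k + f)) ≤ l := by
    rcases hFk'.eq_or_lt with e | e
    · rw [e]
      refine le_of_eq ?_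
      have : 0 < l := by linarith
      have ec : c = l + 1 - t := by rw [hl]; ring
      have : l - k + k = l := by ring
      rw [this, ec]
      have : (0 : ℝ) < k := by linarith
      field_simp
      linear_combination hroot'
    · have := quotient_row_lt hf e hr hkl ht hl hroot'
      linarith
  have hrows : ∀ i, ∑ j ∈ H.neighborFinset i, w j ≤ l * w i := by
    intro i
    by_cases hiF : i ∈ F
    · rw [hw, h.row_of_mem _ _ hiF]
      simpa [weight, hiF] using hrowF
    · by_cases hi : i ∈ C
      · rw [hw, h.row_of_notMem _ _ hi hiF]
        simp only [weight, hiF, hi, if_true, if_false]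
        refine le_of_eq ?_
        change f + (c - f) * (f / (t + f)) - f / (t + f) = _
        rw [hl]; field_simp; ring
      · rw [hw, h.row_of_notMem_clique _ _ hi]
        simp only [weight, hiF, hi, if_false]
        refine le_of_eq ?_
        change f + (k - f) * (f / (l - k + f)) = _
        field_simp; ring
  have hwpos : ∀ i, 0 < w i := by
    intro i
    simp only [hw, weight]
    split_ifs <;> positivity
  have hdom : ∀ v, v ≠ d → H.Adj d v := by
    intro v hv
    rw [← mem_neighborFinset, h.neighborFinset_of_mem hd]
    by_cases hvC : v ∈ C <;> simp [hv, hvC]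
  obtain ⟨hG, heq⟩ := eq_of_dominating hGH hwpos (by linarith : 0 < l) hrows hρ hdom
  refine ⟨hG, ?_⟩
  by_contra hne
  have hlt : f < k := by
    have : F.card < k := lt_of_le_of_ne hFk hne
    exact Nat.cast_lt.mpr this
  have e := heq d
  rw [hw, h.row_of_mem _ _ hd] at e
  simp only [weight, hd, if_true, mul_one] at e
  have := quotient_row_lt hf hlt hr hkl ht hl hroot'
  change f + (c - f) * (f / (t + f)) - 1 + r * (f / (l - k + f)) = l at e
  linarith

/-- If `F` is empty, the spectral radius is at most that of the clique `C`. -/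
theorem spectralRadius_le_of_empty (h : H.IsCliqueSplit k C ∅) {G : SimpleGraph V}
    [DecidableRel G.Adj] [Nonempty V] (hGH : G ≤ H) (hkC : k < C.card) :
    G.spectralRadius ≤ (C.card : ℝ) - 1 := by
  by_contra! hlt
  obtain ⟨u, hu, hGu⟩ := G.exists_eigenvector_spectralRadius
  have hkC' : (k : ℝ) + 1 ≤ C.card := by exact_mod_cast hkC
  have hk0 : (0 : ℝ) ≤ k := by positivity
  have hrows : ∀ i, ∑ j ∈ H.neighborFinset i, (1 : ℝ) ≤ (C.card - 1) * 1 := by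
    intro i
    rw [Finset.sum_const, card_neighborFinset_eq_degree, nsmul_one, mul_one]
    by_cases hi : i ∈ C
    · rw [← card_neighborFinset_eq_degree, h.neighborFinset_of_notMem hi (by simp),
        Finset.card_erase_of_mem hi, Nat.cast_sub (Finset.card_pos.mpr ⟨i, hi⟩)]
      simp
    · rw [h.degree_eq i hi]; linarith
  obtain ⟨h1, -, -⟩ := eigenvector_rigidity hGH (w := fun _ => 1) (fun _ => one_pos)
    (by linarith) hrows hlt.le hGu
  obtain ⟨i, hi⟩ := Function.ne_iff.mp hu
  have hi : 0 < |u i| := abs_pos.mpr hi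
  have := mul_abs_le_sum_neighborFinset G (by linarith) hGu i
  rw [h1 i] at this
  nlinarith

/-- For `k = 0` the extremal graph `K_c + K_1` is disconnected; equality still holds since the
eigenvector is supported on the clique. -/
theorem eq_of_zero (h : H.IsCliqueSplit 0 C ∅) {G : SimpleGraph V} [DecidableRel G.Adj]
    [Nonempty V] (hGH : G ≤ H) (hC : 2 ≤ C.card) (hρ : (C.card : ℝ) - 1 ≤ G.spectralRadius) :
    G = H := by
  obtain ⟨u, hu, hGu⟩ := G.exists_eigenvector_spectralRadius
  have hC' : (2 : ℝ) ≤ C.card := by exact_mod_cast hC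
  have hiso : ∀ i, i ∉ C → H.neighborFinset i = ∅ := fun i hi =>
    Finset.card_eq_zero.mp ((card_neighborFinset_eq_degree _ _).trans (h.degree_eq i hi))
  have hclique : ∀ i ∈ C, H.neighborFinset i = C.erase i := fun i hi =>
    h.neighborFinset_of_notMem hi (by simp)
  have hrows : ∀ i, ∑ j ∈ H.neighborFinset i, (1 : ℝ) ≤ (C.card - 1) * 1 := by
    intro i
    by_cases hi : i ∈ C
    · rw [hclique i hi, Finset.sum_const, Finset.card_erase_of_mem hi, nsmul_one,
        Nat.cast_sub (by omega)]
      simp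
    · rw [hiso i hi, Finset.sum_empty]; linarith
  obtain ⟨h1, h2, -⟩ := eigenvector_rigidity hGH (w := fun _ => 1) (fun _ => one_pos)
    (by linarith) hrows hρ hGu
  have hz : ∀ i, i ∉ C → u i = 0 := by
    intro i hi
    have := h2 i
    rw [hiso i hi, Finset.sum_empty, eq_comm, mul_eq_zero, abs_eq_zero] at this
    exact this.resolve_left (by linarith)
  obtain ⟨i₀, hi₀⟩ := Function.ne_iff.mp hu
  have hi₀C : i₀ ∈ C := by
    by_contra hi; exact hi₀ (hz i₀ hi)
  have hi₀ : 0 < |u i₀| := abs_pos.mpr hi₀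
  have hpos : ∀ i ∈ C, 0 < |u i| := by
    intro i hi
    rcases eq_or_ne i i₀ with rfl | hne
    · exact hi₀
    · have : 0 < ((C.card : ℝ) - 1) * |u i| := by
        rw [← h2 i]
        exact Finset.sum_pos' (fun _ _ => abs_nonneg _)
          ⟨i₀, by rw [hclique i hi]; simp [hne.symm, hi₀C], hi₀⟩
      exact (mul_pos_iff_of_pos_left (by linarith)).mp this
  refine le_antisymm hGH fun i j hij => ?_
  have hjC : j ∈ C := by
    by_contra hj
    have : i ∈ H.neighborFinset j := by simpa using hij.symm
    simp [hiso j hj] at this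
  exact adj_of_sum_neighborFinset_eq hGH (fun _ => abs_nonneg _) ((h1 i).trans (h2 i).symm)
    (hpos j hjC) hij

end IsCliqueSplit

end Comparison

/-! ### Large cliques in dense graphs -/

section Cliques

variable {V : Type*} [Fintype V] [DecidableEq V]

/-- Double counting of the edges between `C` and its complement. -/
theorem sum_degree_le (H : SimpleGraph V) [DecidableRel H.Adj] (C : Finset V) :
    (∑ v, (H.degree v : ℝ)) ≤ C.card * (C.card - 1) +
      ∑ v ∈ Cᶜ, (((H.neighborFinset v ∩ C).card : ℝ) + H.degree v) := by
  have h1 : ∀ v ∈ C, (H.degree v : ℝ) ≤ (C.card - 1) + ((H.neighborFinset v ∩ Cᶜ).card : ℝ) := by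
    intro v hv
    have hsub : H.neighborFinset v ⊆ C.erase v ∪ (H.neighborFinset v ∩ Cᶜ) := by
      intro u hu
      by_cases huC : u ∈ C
      · have : u ≠ v := ((mem_neighborFinset _ _ _).mp hu).ne'
        simp [this, huC]
      · simp_all
    have := (Finset.card_le_card hsub).trans (Finset.card_union_le _ _)
    rw [card_neighborFinset_eq_degree] at this
    have e : ((C.erase v).card : ℝ) = C.card - 1 := by
      rw [Finset.card_erase_of_mem hv, Nat.cast_sub (Finset.card_pos.mpr ⟨v, hv⟩)]; simp
    rw [← e]; exact_mod_cast this
  have h2 : ∑ v ∈ C, (H.neighborFinset v ∩ Cᶜ).card = ∑ v ∈ Cᶜ, (H.neighborFinset v ∩ C).card := by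
    have := Finset.sum_card_bipartiteAbove_eq_sum_card_bipartiteBelow (s := C) (t := Cᶜ) H.Adj
    convert this using 3 with v hv v hv
    · ext u; simp [Finset.bipartiteAbove, and_comm]
    · ext u; simp [Finset.bipartiteBelow, and_comm, H.adj_comm]
  rw [← Finset.sum_add_sum_compl C, Finset.sum_add_distrib, ← add_assoc]
  refine add_le_add_left ?_ _
  calc _ ≤ ∑ v ∈ C, (((C.card : ℝ) - 1) + ((H.neighborFinset v ∩ Cᶜ).card : ℝ)) :=
        Finset.sum_le_sum h1
    _ = _ := by
        rw [Finset.sum_add_distrib, Finset.sum_const, nsmul_eq_mul]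
        congr 1
        exact_mod_cast h2

/-- A dense graph in which nonadjacent vertices have small degree sum has a clique containing all
but `k + s` vertices, with the vertices outside it attached as in `IsCliqueSplit`.
The clique is a maximal one containing all vertices of degree at least `(n - s) / 2`. -/
theorem exists_isCliqueSplit (H : SimpleGraph V) [DecidableRel H.Adj] {n k s : ℕ} (hs : s ≤ 1)
    (hcard : Fintype.card V = n) (hn : 6 * k + 5 + 5 * s ≤ n) (hk : ∀ v, k ≤ H.degree v)
    (hcl : ∀ u v, u ≠ v → ¬ H.Adj u v → H.degree u + H.degree v + 1 + s ≤ n) (hne : H ≠ ⊤)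
    (hedge : ((n : ℝ) - k - s - 1) * (n - k - s - 2) + 2 * (k + 1 + s) * (k + 1) <
      ∑ v, (H.degree v : ℝ)) :
    ∃ C F : Finset V, H.IsCliqueSplit k C F ∧ C.card + k + s = n := by
  have hheavy : H.IsClique
      ((Finset.univ.filter fun v => n ≤ 2 * H.degree v + s : Finset V) : Set V) := by
    intro u hu v hv huv
    simp only [Finset.coe_filter, Finset.mem_univ, true_and, Set.mem_ofPred_eq] at hu hv
    by_contra hadj
    have := hcl u v huv hadj
    omega
  obtain ⟨C, hWC, hC⟩ := Finite.exists_le_maximal (p := fun C : Finset V => H.IsClique (C : Set V))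
    hheavy
  have hnon : ∀ v, v ∉ C → ∃ c ∈ C, ¬ H.Adj v c := by
    intro v hv
    by_contra! hall
    have : H.IsClique ((insert v C : Finset V) : Set V) := by
      rw [Finset.coe_insert, isClique_insert]
      exact ⟨hC.prop, fun b hb _ => hall b hb⟩
    exact hv (hC.le_of_ge this (Finset.subset_insert v C) (Finset.mem_insert_self v C))
  have hlight : ∀ v, v ∉ C → 2 * H.degree v + s + 1 ≤ n := by
    intro v hv
    by_contra! hlt
    exact hv (hWC (by simp only [Finset.mem_filter, Finset.mem_univ, true_and]; omega))
  have hdegC : ∀ c ∈ C, C.card ≤ H.degree c + 1 := by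
    intro c hc
    have : C.erase c ⊆ H.neighborFinset c := fun u hu => by
      rw [Finset.mem_erase] at hu
      simpa using hC.prop hc hu.2 hu.1.symm
    have := Finset.card_le_card this
    rw [Finset.card_erase_of_mem hc, card_neighborFinset_eq_degree] at this
    omega
  have hdegout : ∀ v, v ∉ C → H.degree v + C.card + s ≤ n := by
    intro v hv
    obtain ⟨c, hc, hvc⟩ := hnon v hv
    have := hcl v c (fun e => hv (e ▸ hc)) hvc
    have := hdegC c hc
    omega
  have hint : ∀ v, v ∉ C → (H.neighborFinset v ∩ C).card + 1 ≤ C.card := by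
    intro v hv
    obtain ⟨c, hc, hvc⟩ := hnon v hv
    refine Finset.card_lt_card ⟨Finset.inter_subset_right, fun hsub => hvc ?_⟩
    simpa using (Finset.mem_inter.mp (hsub hc)).1
  have hcc : (Cᶜ.card : ℝ) = n - C.card := by
    rw [Finset.card_compl, hcard, Nat.cast_sub (hcard ▸ Finset.card_le_univ C)]
  have hsum := H.sum_degree_le C
  have hlarge : n ≤ C.card + k + s := by
    by_contra! hlt
    have hA : ∑ v ∈ Cᶜ, (((H.neighborFinset v ∩ C).card : ℝ) + H.degree v) ≤
        (n - C.card) * ((C.card - 1) + (n - 1 - s) / 2) := by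
      rw [← hcc, ← nsmul_eq_mul]
      refine Finset.sum_le_card_nsmul _ _ _ fun v hv => ?_
      have h1 : ((H.neighborFinset v ∩ C).card : ℝ) + 1 ≤ C.card := by
        exact_mod_cast hint v (Finset.mem_compl.mp hv)
      have h2 : 2 * (H.degree v : ℝ) + s + 1 ≤ n := by
        exact_mod_cast hlight v (Finset.mem_compl.mp hv)
      linarith
    have hB : ∑ v ∈ Cᶜ, (((H.neighborFinset v ∩ C).card : ℝ) + H.degree v) ≤
        (n - C.card) * (2 * (n - C.card - s)) := by
      rw [← hcc, ← nsmul_eq_mul]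
      refine Finset.sum_le_card_nsmul _ _ _ fun v hv => ?_
      have h1 : ((H.neighborFinset v ∩ C).card : ℝ) ≤ H.degree v := by
        rw [← card_neighborFinset_eq_degree]
        exact_mod_cast Finset.card_le_card Finset.inter_subset_left
      have h2 : (H.degree v : ℝ) + C.card + s ≤ n := by
        exact_mod_cast hdegout v (Finset.mem_compl.mp hv)
      rw [hcc]
      linarith
    have ht : (C.card : ℝ) + k + s + 1 ≤ n := by exact_mod_cast hlt
    have hn' : 6 * (k : ℝ) + 5 + 5 * s ≤ n := by exact_mod_cast hn
    have hk0 : (0 : ℝ) ≤ k := by positivity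
    have hs' : (s : ℝ) = 0 ∨ (s : ℝ) = 1 := by
      rcases Nat.le_one_iff_eq_zero_or_eq_one.mp hs with rfl | rfl <;> simp
    generalize (C.card : ℝ) = t at *
    generalize (n : ℝ) = N at *
    generalize (k : ℝ) = K at *
    generalize (s : ℝ) = σ at *
    -- `t (t - 1) + 2 (N - t) (N - t - σ)` takes equal values at the threshold and at `N - K - σ - 1`
    rcases le_total (3 * t) (N + 3 * K + σ + 4) with hcase | hcase
    · have h1 : N * (t - 1) + (N - t) * (N - 1 - σ) / 2 ≤
          N * ((N + 3 * K + σ + 4) / 3 - 1) + (N - (N + 3 * K + σ + 4) / 3) * (N - 1 - σ) / 2 := by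
        have : 0 ≤ (N + 3 * K + σ + 4 - 3 * t) * (N + 1 + σ) :=
          mul_nonneg (by linarith) (by rcases hs' with h | h <;> linarith)
        linarith
      have h2 : N * ((N + 3 * K + σ + 4) / 3 - 1) + (N - (N + 3 * K + σ + 4) / 3) * (N - 1 - σ) / 2
          ≤ (N - K - σ - 1) * (N - K - σ - 2) + 2 * (K + 1 + σ) * (K + 1) := by
        rcases hs' with rfl | rfl
        · nlinarith [mul_nonneg hk0 (sub_nonneg.mpr hn'), sq_nonneg (N - 6 * K - 5)]
        · nlinarith [mul_nonneg hk0 (sub_nonneg.mpr hn'), sq_nonneg (N - 6 * K - 10)]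
      nlinarith
    · have : 0 ≤ (N - K - σ - 1 - t) * (3 * t - (N + 3 * K + σ + 4)) :=
        mul_nonneg (by linarith) (by linarith)
      nlinarith
  obtain ⟨v₀, hv₀⟩ : ∃ v, v ∉ C := by
    by_contra! hall
    refine hne (eq_top_iff.mpr fun u v huv => hC.prop (hall u) (hall v) huv)
  have hcardC : C.card + k + s = n := by
    have := hdegout v₀ hv₀
    have := hk v₀
    omega
  have hdeg : ∀ v, v ∉ C → H.degree v = k := fun v hv => by
    have := hdegout v hv
    have := hk v
    omega
  refine ⟨C, C.filter fun u => ∃ v, v ∉ C ∧ H.Adj v u,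
    ⟨hC.prop, Finset.filter_subset _ _, fun v hv u hu => ?_, hdeg⟩, hcardC⟩
  rw [Finset.mem_filter]
  refine ⟨fun hvu => ⟨hu, v, hv, hvu⟩, fun ⟨_, x, hx, hxu⟩ => ?_⟩
  by_contra hvu
  have h1 := hcl v u (fun e => hv (e ▸ hu)) hvu
  have h2 : insert x (C.erase u) ⊆ H.neighborFinset u := by
    intro y hy
    rw [Finset.mem_insert, Finset.mem_erase] at hy
    rw [mem_neighborFinset]
    rcases hy with rfl | hy
    · exact hxu.symm
    · exact hC.prop hu hy.2 hy.1.symm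
  have h3 := Finset.card_le_card h2
  rw [Finset.card_insert_of_notMem (fun hx' => hx (Finset.mem_of_mem_erase hx')),
    Finset.card_erase_of_mem hu, card_neighborFinset_eq_degree] at h3
  have := Finset.card_pos.mpr ⟨u, hu⟩
  have := hdeg v hv
  omega

end Cliques

/-! ### Hamilton paths and cycles as sequences; the Bondy–Chvátal exchange -/

section Sequences

/-- The first `n` terms of `q` are distinct and consecutive ones are adjacent. When `n` is the
number of vertices, this is a Hamilton path; sequences are easier to cut and reverse than walks. -/
structure IsPathSeq {V : Type*} (G : SimpleGraph V) (n : ℕ) (q : ℕ → V) : Prop where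
  injOn : ∀ i j, i < n → j < n → q i = q j → i = j
  adj : ∀ i, i + 1 < n → G.Adj (q i) (q (i + 1))

/-- A path sequence whose last term is adjacent to its first. -/
structure IsCycleSeq {V : Type*} (G : SimpleGraph V) (n : ℕ) (q : ℕ → V) : Prop
    extends IsPathSeq G n q where
  closing : G.Adj (q (n - 1)) (q 0)

variable {V W : Type*}

theorem IsPathSeq.mono {G H : SimpleGraph V} (h : G ≤ H) {n : ℕ} {q : ℕ → V}
    (hq : G.IsPathSeq n q) : H.IsPathSeq n q :=
  ⟨hq.injOn, fun i hi => h (hq.adj i hi)⟩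

theorem IsCycleSeq.mono {G H : SimpleGraph V} (h : G ≤ H) {n : ℕ} {q : ℕ → V}
    (hq : G.IsCycleSeq n q) : H.IsCycleSeq n q :=
  ⟨hq.toIsPathSeq.mono h, h hq.closing⟩

theorem IsPathSeq.map {G : SimpleGraph V} {H : SimpleGraph W} (e : G ≃g H) {n : ℕ} {q : ℕ → V}
    (hq : G.IsPathSeq n q) : H.IsPathSeq n (e ∘ q) :=
  ⟨fun i j hi hj h => hq.injOn i j hi hj (e.injective h),
    fun i hi => e.map_adj_iff.mpr (hq.adj i hi)⟩

theorem IsCycleSeq.map {G : SimpleGraph V} {H : SimpleGraph W} (e : G ≃g H) {n : ℕ} {q : ℕ → V}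
    (hq : G.IsCycleSeq n q) : H.IsCycleSeq n (e ∘ q) :=
  ⟨hq.toIsPathSeq.map e, e.map_adj_iff.mpr hq.closing⟩

theorem IsPathSeq.exists_eq [Fintype V] {G : SimpleGraph V} {n : ℕ} {q : ℕ → V}
    (hq : G.IsPathSeq n q) (hn : Fintype.card V = n) (v : V) : ∃ i < n, q i = v := by
  have hinj : Function.Injective fun i : Fin n => q i := fun i j h =>
    Fin.ext (hq.injOn i j i.2 j.2 h)
  have := ((Fintype.bijective_iff_injective_and_card _).mpr ⟨hinj, by simp [hn]⟩).2 v
  obtain ⟨i, hi⟩ := this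
  exact ⟨i, i.2, hi⟩

theorem exists_walk_of_adj (G : SimpleGraph V) (q : ℕ → V) (m : ℕ)
    (h : ∀ i, i < m → G.Adj (q i) (q (i + 1))) :
    ∃ p : G.Walk (q 0) (q m), p.length = m ∧ ∀ i ≤ m, p.getVert i = q i := by
  induction m with
  | zero => exact ⟨.nil, rfl, fun i hi => by simp [Nat.le_zero.mp hi]⟩
  | succ m ih =>
    obtain ⟨p, hp, hpi⟩ := ih fun i hi => h i (by omega)
    refine ⟨p.append (.cons (h m (by omega)) .nil), by simp [hp], fun i hi => ?_⟩
    rw [Walk.getVert_append', hp]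
    split_ifs with hi'
    · exact hpi i hi'
    · obtain rfl : i = m + 1 := by omega
      simp

theorem IsPathSeq.exists_path {G : SimpleGraph V} {n : ℕ} {q : ℕ → V} (hn : 1 ≤ n)
    (hq : G.IsPathSeq n q) : ∃ p : G.Walk (q 0) (q (n - 1)), p.IsPath ∧ p.length = n - 1 ∧
      ∀ i ≤ n - 1, p.getVert i = q i := by
  obtain ⟨p, hp, hpi⟩ := G.exists_walk_of_adj q (n - 1) fun i hi => hq.adj i (by omega)
  refine ⟨p, ?_, hp, hpi⟩
  rw [← Walk.IsPath.getVert_injOn_iff]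
  intro i hi j hj h
  rw [Set.mem_ofPred_eq, hp] at hi hj
  rw [hpi i hi, hpi j hj] at h
  exact hq.injOn i j (by omega) (by omega) h

theorem isTraceable_iff_exists_isPathSeq [Fintype V] [DecidableEq V] (G : SimpleGraph V) {n : ℕ}
    (hn : Fintype.card V = n) (hn1 : 1 ≤ n) : G.IsTraceable ↔ ∃ q, G.IsPathSeq n q := by
  constructor
  · rintro ⟨a, b, p, hp⟩
    have hl := hp.length_eq
    rw [hn] at hl
    refine ⟨p.getVert, fun i j hi hj h => ?_, fun i hi => p.adj_getVert_succ (by omega)⟩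
    exact hp.isPath.getVert_injOn (by rw [Set.mem_ofPred_eq]; omega)
      (by rw [Set.mem_ofPred_eq]; omega) h
  · rintro ⟨q, hq⟩
    obtain ⟨p, hp, hl, -⟩ := hq.exists_path hn1
    exact ⟨_, _, p, Walk.isHamiltonian_iff_isPath_and_length_eq.mpr ⟨hp, by rw [hl, hn]⟩⟩

theorem isHamiltonian_iff_exists_isCycleSeq [Fintype V] [DecidableEq V] (G : SimpleGraph V) {n : ℕ}
    (hn : Fintype.card V = n) (hn3 : 3 ≤ n) : G.IsHamiltonian ↔ ∃ q, G.IsCycleSeq n q := by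
  constructor
  · intro h
    obtain ⟨a, p, hp⟩ := h (by omega)
    have hl := hp.length_eq
    rw [hn] at hl
    refine ⟨p.getVert, ⟨fun i j hi hj h => ?_, fun i hi => p.adj_getVert_succ (by omega)⟩, ?_⟩
    · exact hp.isCycle.getVert_injOn' (by rw [Set.mem_ofPred_eq]; omega)
        (by rw [Set.mem_ofPred_eq]; omega) h
    · rw [p.getVert_zero]
      have := p.adj_getVert_succ (i := n - 1) (by omega)
      rwa [show n - 1 + 1 = p.length by omega, p.getVert_length] at this
  · rintro ⟨q, hq⟩ -
    obtain ⟨p, hp, hl, hpi⟩ := hq.toIsPathSeq.exists_path (by omega)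
    refine ⟨_, Walk.cons hq.closing p, ?_⟩
    rw [Walk.isHamiltonianCycle_iff_isCycle_and_length_eq, Walk.cons_isCycle_iff,
      Walk.mk_mem_edges_iff_exists]
    refine ⟨⟨hp, ?_⟩, by rw [Walk.length_cons, hl]; omega⟩
    rintro ⟨i, hi, h⟩
    rw [hpi i (by omega), hpi (i + 1) (by omega), Sym2.eq_iff] at h
    rcases h with ⟨h1, -⟩ | ⟨h1, h2⟩
    · have := hq.injOn _ _ (by omega) (by omega) h1; omega
    · have := hq.injOn _ _ (by omega) (by omega) h1
      have := hq.injOn _ _ (by omega) (by omega) h2; omega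

theorem IsCycleSeq.rotate {G : SimpleGraph V} {n : ℕ} {q : ℕ → V} (hq : G.IsCycleSeq n q) {m : ℕ}
    (hm : m < n) : G.IsCycleSeq n fun i => if m + i < n then q (m + i) else q (m + i - n) := by
  refine ⟨⟨fun i j hi hj h => ?_, fun i hi => ?_⟩, ?_⟩
  · split_ifs at h <;>
    · have := hq.injOn _ _ (by omega) (by omega) h
      omega
  · split_ifs with h1 h2 h2
    · exact hq.adj (m + i) h2
    · rw [show m + i = n - 1 by omega, show m + (i + 1) - n = 0 by omega]
      exact hq.closing
    · omega
    · rw [show m + (i + 1) - n = m + i - n + 1 by omega]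
      exact hq.adj _ (by omega)
  · rcases Nat.eq_zero_or_pos m with rfl | hm0
    · rw [if_pos (by omega), if_pos (by omega), zero_add]
      exact hq.closing
    · rw [if_neg (by omega), if_pos (by omega), show m + (n - 1) - n = m - 1 by omega]
      have := hq.adj (m - 1) (by omega)
      rwa [show m - 1 + 1 = m + 0 by omega] at this

/-- Ore's exchange: a Hamilton path whose ends have degree sum at least `n` can be
closed up to a Hamilton cycle after reversing a final segment. -/
theorem IsPathSeq.exists_isCycleSeq [Fintype V] {G : SimpleGraph V} [DecidableRel G.Adj]
    {n : ℕ} {q : ℕ → V} (hq : G.IsPathSeq n q) (hn : Fintype.card V = n) (hn1 : 1 ≤ n)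
    (hdeg : n ≤ G.degree (q 0) + G.degree (q (n - 1))) : ∃ q, G.IsCycleSeq n q := by
  classical
  obtain ⟨i, hi, h1, h2⟩ : ∃ i, i + 1 < n ∧ G.Adj (q 0) (q (i + 1)) ∧
      G.Adj (q i) (q (n - 1)) := by
    set A := (Finset.range (n - 1)).filter fun i => G.Adj (q 0) (q (i + 1))
    set B := (Finset.range (n - 1)).filter fun i => G.Adj (q i) (q (n - 1))
    have hA : G.degree (q 0) ≤ A.card := by
      rw [← card_neighborFinset_eq_degree]
      refine (Finset.card_le_card fun v hv => ?_).trans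
        (Finset.card_image_le (f := fun i => q (i + 1)))
      rw [mem_neighborFinset] at hv
      obtain ⟨i, hi, rfl⟩ := hq.exists_eq hn v
      have hi0 : i ≠ 0 := by rintro rfl; exact hv.ne rfl
      have e : i - 1 + 1 = i := by omega
      refine Finset.mem_image.mpr ⟨i - 1, ?_, by rw [e]⟩
      rw [Finset.mem_filter, Finset.mem_range, e]
      exact ⟨by omega, hv⟩
    have hB : G.degree (q (n - 1)) ≤ B.card := by
      rw [← card_neighborFinset_eq_degree]
      refine (Finset.card_le_card fun v hv => ?_).trans (Finset.card_image_le (f := q))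
      rw [mem_neighborFinset] at hv
      obtain ⟨i, hi, rfl⟩ := hq.exists_eq hn v
      have hi0 : i ≠ n - 1 := by rintro rfl; exact hv.ne rfl
      refine Finset.mem_image.mpr ⟨i, ?_, rfl⟩
      rw [Finset.mem_filter, Finset.mem_range]
      exact ⟨by omega, hv.symm⟩
    by_contra! hno
    have hdisj : Disjoint A B := Finset.disjoint_left.mpr fun i hiA hiB => by
      rw [Finset.mem_filter, Finset.mem_range] at hiA hiB
      exact hno i (by omega) hiA.2 hiB.2
    have : (A ∪ B).card ≤ n - 1 := by
      simpa using Finset.card_le_card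
        (Finset.union_subset (Finset.filter_subset _ _) (Finset.filter_subset _ _) :
          A ∪ B ⊆ Finset.range (n - 1))
    rw [Finset.card_union_of_disjoint hdisj] at this
    omega
  refine ⟨fun j => if j ≤ i then q j else q (n + i - j), ⟨fun a b ha hb h => ?_, fun j hj => ?_⟩, ?_⟩
  · split_ifs at h <;>
    · have := hq.injOn _ _ (by omega) (by omega) h
      omega
  · split_ifs with h3 h4 h4
    · exact hq.adj j hj
    · obtain rfl : j = i := by omega
      rwa [show n + j - (j + 1) = n - 1 by omega]
    · omega
    · have := hq.adj (n + i - (j + 1)) (by omega)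
      rw [show n + i - (j + 1) + 1 = n + i - j by omega] at this
      exact this.symm
  · rw [if_neg (by omega), if_pos (by omega), show n + i - (n - 1) = i + 1 by omega]
    exact h1.symm

/-- The Bondy–Chvátal step: joining two vertices of degree sum at least `n` does not create
Hamiltonicity. -/
theorem IsCycleSeq.of_sup_edge [Fintype V] {G : SimpleGraph V} [DecidableRel G.Adj]
    {n : ℕ} {q : ℕ → V} {u v : V} (hq : (G ⊔ edge u v).IsCycleSeq n q)
    (hn : Fintype.card V = n) (hn3 : 3 ≤ n) (hdeg : n ≤ G.degree u + G.degree v) :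
    ∃ q, G.IsCycleSeq n q := by
  have hpair : ∀ a b, (G ⊔ edge u v).Adj a b → ¬ G.Adj a b → (a = u ∧ b = v) ∨ (a = v ∧ b = u) := by
    intro a b hab hG
    rw [sup_adj, edge_adj] at hab
    exact (hab.resolve_left hG).1
  -- rotate so that the added edge, if used, closes the cycle
  suffices hmain : ∀ q, (G ⊔ edge u v).IsCycleSeq n q → ¬ G.Adj (q (n - 1)) (q 0) →
      ∃ q, G.IsCycleSeq n q by
    by_cases hcl : G.Adj (q (n - 1)) (q 0)
    · by_cases hall : ∀ i, i + 1 < n → G.Adj (q i) (q (i + 1))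
      · exact ⟨q, ⟨hq.injOn, hall⟩, hcl⟩
      · push Not at hall
        obtain ⟨i, hi, hGi⟩ := hall
        refine hmain _ (hq.rotate (m := i + 1) hi) ?_
        rwa [if_neg (by omega), if_pos (by omega), show i + 1 + (n - 1) - n = i by omega]
    · exact hmain q hq hcl
  intro q hq hcl
  have hends := hpair _ _ hq.closing hcl
  have hpath : G.IsPathSeq n q := by
    refine ⟨hq.injOn, fun i hi => ?_⟩
    by_contra hG
    have hi' := hpair _ _ (hq.adj i hi) hG
    have key : (q i = q 0 ∧ q (i + 1) = q (n - 1)) ∨ (q i = q (n - 1)) := by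
      rcases hends with ⟨e1, e2⟩ | ⟨e1, e2⟩ <;> rcases hi' with ⟨e3, e4⟩ | ⟨e3, e4⟩ <;> simp [*]
    rcases key with ⟨h1, h2⟩ | h1
    · have := hq.injOn _ _ (by omega) (by omega) h1
      have := hq.injOn _ _ (by omega) (by omega) h2
      omega
    · have := hq.injOn _ _ (by omega) (by omega) h1
      omega
  refine hpath.exists_isCycleSeq hn (by omega) ?_
  rcases hends with ⟨e1, e2⟩ | ⟨e1, e2⟩ <;> rw [e1, e2] <;> omega

/-- The graph obtained by adding the vertex `none`, adjacent to all others. -/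
def cone (G : SimpleGraph V) : SimpleGraph (Option V) where
  Adj a b := a ≠ b ∧ ∀ u ∈ a, ∀ v ∈ b, G.Adj u v
  symm := ⟨fun _ _ h => ⟨h.1.symm, fun u hu v hv => (h.2 v hv u hu).symm⟩⟩
  loopless := ⟨fun _ h => h.1 rfl⟩

@[simp]
theorem cone_adj_some (G : SimpleGraph V) (u v : V) :
    G.cone.Adj (some u) (some v) ↔ G.Adj u v := by
  simp only [cone, ne_eq, Option.some.injEq, Option.mem_def, forall_eq']
  exact ⟨fun h => h.2, fun h => ⟨h.ne, h⟩⟩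

@[simp]
theorem cone_adj_none (G : SimpleGraph V) (v : V) : G.cone.Adj none (some v) := by
  simp [cone]

theorem degree_cone_some [Fintype V] (G : SimpleGraph V) [DecidableRel G.Adj]
    [DecidableRel G.cone.Adj] (v : V) : G.cone.degree (some v) = G.degree v + 1 := by
  rw [← card_neighborFinset_eq_degree, ← card_neighborFinset_eq_degree,
    ← Finset.card_insertNone]
  congr 1
  ext (_ | u)
  · simpa using (G.cone_adj_none v).symm
  · simp

theorem cone_sup_edge_le (G : SimpleGraph V) (u v : V) :
    (G ⊔ edge u v).cone ≤ G.cone ⊔ edge (some u) (some v) := by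
  rintro (_ | a) (_ | b) h
  · exact absurd rfl h.1
  · exact Or.inl (G.cone_adj_none b)
  · exact Or.inl (G.cone_adj_none a).symm
  · rw [cone_adj_some, sup_adj, edge_adj] at h
    rw [sup_adj, edge_adj, cone_adj_some]
    simpa using h

theorem exists_isPathSeq_iff_cone [Fintype V] (G : SimpleGraph V) {n : ℕ}
    (hn : Fintype.card V = n) (hn1 : 1 ≤ n) :
    (∃ q, G.IsPathSeq n q) ↔ ∃ q, G.cone.IsCycleSeq (n + 1) q := by
  constructor
  · rintro ⟨q, hq⟩
    refine ⟨fun i => if i = 0 then none else some (q (i - 1)), ⟨fun i j hi hj h => ?_,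
      fun i hi => ?_⟩, ?_⟩
    · split_ifs at h with h1 h2 h2
      · omega
      · have := hq.injOn _ _ (by omega) (by omega) (Option.some.inj h)
        omega
    · rw [if_neg (by omega : ¬ i + 1 = 0)]
      split_ifs with h1
      · exact G.cone_adj_none _
      · rw [cone_adj_some]
        have := hq.adj (i - 1) (by omega)
        rwa [show i - 1 + 1 = i + 1 - 1 by omega] at this
    · rw [if_neg (by omega), if_pos rfl]
      exact (G.cone_adj_none _).symm
  · rintro ⟨q, hq⟩
    obtain ⟨m, hm, hqm⟩ := hq.toIsPathSeq.exists_eq (by simp [hn]) none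
    obtain ⟨q', hq', h0⟩ : ∃ q', G.cone.IsCycleSeq (n + 1) q' ∧ q' 0 = none :=
      ⟨_, hq.rotate hm, by simpa [hm] using hqm⟩
    have hsome : ∀ i, ∃ v, i < n → q' (i + 1) = some v := by
      intro i
      by_cases hi : i < n
      · obtain ⟨v, hv⟩ := Option.ne_none_iff_exists'.mp (show q' (i + 1) ≠ none from fun h => by
          have := hq'.injOn _ _ (by omega) (by omega) (h.trans h0.symm)
          omega)
        exact ⟨v, fun _ => hv⟩
      · have : Nonempty V := Fintype.card_pos_iff.mp (by omega)
        exact ⟨Classical.arbitrary V, fun h => absurd h hi⟩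
    choose r hr using hsome
    refine ⟨r, fun i j hi hj h => ?_, fun i hi => ?_⟩
    · have := hq'.injOn (i + 1) (j + 1) (by omega) (by omega) (by rw [hr i hi, hr j hj, h])
      omega
    · have := hq'.adj (i + 1) (by omega)
      rwa [hr i (by omega), hr (i + 1) hi, cone_adj_some] at this

theorem exists_isCycleSeq_top [Fintype V] {n : ℕ} (hn : Fintype.card V = n) (hn2 : 2 ≤ n) :
    ∃ q, (⊤ : SimpleGraph V).IsCycleSeq n q := by
  let e := Fintype.equivFinOfCardEq hn
  let q : ℕ → V := fun i => if h : i < n then e.symm ⟨i, h⟩ else e.symm ⟨0, by omega⟩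
  have hinj : ∀ i j, i < n → j < n → q i = q j → i = j := by
    intro i j hi hj h
    simpa [q, hi, hj] using h
  refine ⟨q, ⟨hinj, fun i hi h => ?_⟩, fun h => ?_⟩
  · have := hinj _ _ (by omega) hi h; omega
  · have := hinj _ _ (by omega) (by omega) h; omega

/-- If the neighbours of the vertices of `R` all lie in a set `F` no larger than `R`, then a
Hamilton cycle alternates between `R` and `F` and so misses every other vertex. -/
theorem IsCycleSeq.mem_of_card_le [Fintype V] [DecidableEq V] {G : SimpleGraph V} {n : ℕ}
    {q : ℕ → V} (hq : G.IsCycleSeq n q) (hn : Fintype.card V = n) {F R : Finset V}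
    (hR : R.Nonempty) (hFR : F.card ≤ R.card) (hadj : ∀ v ∈ R, ∀ u, G.Adj v u → u ∈ F) (x : V) :
    x ∈ F ∪ R := by
  wlog h0 : q 0 ∈ R generalizing q
  · obtain ⟨v, hv⟩ := hR
    obtain ⟨m, hm, rfl⟩ := hq.toIsPathSeq.exists_eq hn v
    exact this (hq.rotate hm) (by simpa [hm] using hv)
  have hcard : ∀ S : Finset V, ((Finset.range n).filter fun i => q i ∈ S).card = S.card := by
    intro S
    refine Finset.card_bij (fun i _ => q i) (fun i hi => (Finset.mem_filter.mp hi).2) ?_ ?_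
    · intro i hi j hj h
      simp only [Finset.mem_filter, Finset.mem_range] at hi hj
      exact hq.injOn i j hi.1 hj.1 h
    · intro v hv
      obtain ⟨i, hi, rfl⟩ := hq.toIsPathSeq.exists_eq hn v
      exact ⟨i, by simp [hi, hv], rfl⟩
  -- `p` is the predecessor on the cycle; it maps the indices of `R` onto those of `F`
  let p : ℕ → ℕ := fun i => if i = 0 then n - 1 else i - 1
  have hp : ∀ i, i < n → G.Adj (q (p i)) (q i) := by
    intro i hi
    simp only [p]
    split_ifs with h
    · rw [h]; exact hq.closing
    · have := hq.adj (i - 1) (by omega)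
      rwa [show i - 1 + 1 = i by omega] at this
  have himage : ((Finset.range n).filter fun i => q i ∈ R).image p =
      (Finset.range n).filter fun i => q i ∈ F := by
    refine Finset.eq_of_subset_of_card_le ?_ ?_
    · intro j hj
      simp only [Finset.mem_image, Finset.mem_filter, Finset.mem_range] at hj ⊢
      obtain ⟨i, ⟨hi, hiR⟩, rfl⟩ := hj
      refine ⟨?_, hadj _ hiR _ (hp i hi).symm⟩
      simp only [p]; split_ifs <;> omega
    · rw [Finset.card_image_of_injOn, hcard, hcard]
      · exact hFR
      · intro i hi j hj h
        simp only [Finset.coe_filter, Finset.mem_range, Set.mem_ofPred_eq] at hi hj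
        simp only [p] at h
        split_ifs at h <;> omega
  have hall : ∀ i, i < n → q i ∈ F ∪ R := by
    intro i
    induction i with
    | zero => exact fun _ => Finset.mem_union_right _ h0
    | succ i ih =>
      intro hi
      rcases Finset.mem_union.mp (ih (by omega)) with hF | hRi
      · have : i ∈ ((Finset.range n).filter fun i => q i ∈ R).image p := by
          rw [himage]; simp [hF]; omega
        simp only [Finset.mem_image, Finset.mem_filter, Finset.mem_range] at this
        obtain ⟨j, ⟨hj, hjR⟩, hji⟩ := this
        have : j = i + 1 := by
          simp only [p] at hji
          split_ifs at hji <;> omega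
        exact Finset.mem_union_right _ (this ▸ hjR)
      · exact Finset.mem_union_left _ (hadj _ hRi _ (hq.adj i hi))
  obtain ⟨i, hi, rfl⟩ := hq.toIsPathSeq.exists_eq hn x
  exact hall i hi

end Sequences

/-! ### The extremal graphs -/

section JoinCliqueIndep

variable {a b r : ℕ}

theorem joinCliqueIndep_adj_indep {i : Fin r} {u : Fin a ⊕ (Fin b ⊕ Fin r)}
    (h : (joinCliqueIndep a b r).Adj (.inr (.inr i)) u) : ∃ j, u = .inl j := by
  rcases u with j | j | j
  · exact ⟨j, rfl⟩
  all_goals simp [joinCliqueIndep, join, emptyGraph] at h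

theorem not_isCycleSeq_joinCliqueIndep (hr : 1 ≤ r) (hb : 1 ≤ b) (har : a ≤ r) {n : ℕ}
    (hn : n = a + (b + r)) (q : ℕ → Fin a ⊕ (Fin b ⊕ Fin r)) :
    ¬ (joinCliqueIndep a b r).IsCycleSeq n q := by
  intro hq
  have := hq.mem_of_card_le (by simp [hn])
    (F := Finset.univ.map ⟨Sum.inl, Sum.inl_injective⟩)
    (R := Finset.univ.map ⟨fun i : Fin r => Sum.inr (Sum.inr i),
      Sum.inr_injective.comp Sum.inr_injective⟩)
    ⟨Sum.inr (Sum.inr ⟨0, hr⟩), by simp⟩ (by simpa using har) ?_ (Sum.inr (Sum.inl ⟨0, hb⟩))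
  · simp at this
  · intro v hv u hvu
    obtain ⟨i, -, rfl⟩ := Finset.mem_map.mp hv
    obtain ⟨j, rfl⟩ := joinCliqueIndep_adj_indep hvu
    simp

theorem not_isPathSeq_joinCliqueIndep (hb : 1 ≤ b) (har : a + 1 ≤ r) {n : ℕ}
    (hn : n = a + (b + r)) (q : ℕ → Fin a ⊕ (Fin b ⊕ Fin r)) :
    ¬ (joinCliqueIndep a b r).IsPathSeq n q := by
  intro hq
  obtain ⟨q, hq⟩ := ((joinCliqueIndep a b r).exists_isPathSeq_iff_cone (n := n)
    (by simp [hn]) (by omega)).mp ⟨q, hq⟩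
  have := hq.mem_of_card_le (by simp [hn])
    (F := Finset.insertNone (Finset.univ.map ⟨Sum.inl, Sum.inl_injective⟩))
    (R := Finset.univ.map ⟨fun i : Fin r => some (Sum.inr (Sum.inr i)),
      (Option.some_injective _).comp (Sum.inr_injective.comp Sum.inr_injective)⟩)
    ⟨some (Sum.inr (Sum.inr ⟨0, by omega⟩)), by simp⟩ (by simpa using har) ?_
    (some (Sum.inr (Sum.inl ⟨0, hb⟩)))
  · simp at this
  · intro v hv u hvu
    obtain ⟨i, -, rfl⟩ := Finset.mem_map.mp hv
    rcases u with _ | u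
    · simp
    · obtain ⟨j, rfl⟩ := joinCliqueIndep_adj_indep ((cone_adj_some _ _ _).mp hvu)
      simp

end JoinCliqueIndep

variable {V : Type*} [Fintype V] [DecidableEq V]

theorem IsCliqueSplit.nonempty_iso {H : SimpleGraph V} [DecidableRel H.Adj] {k : ℕ}
    {C F : Finset V} (h : H.IsCliqueSplit k C F) (hF : F.card = k) {b r : ℕ}
    (hC : C.card = k + b) (hr : Cᶜ.card = r) : Nonempty (H ≃g joinCliqueIndep k b r) := by
  have hCF : (C \ F).card = b := by
    rw [Finset.card_sdiff_of_subset h.subset]; omega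
  let e₁ := (F.equivFinOfCardEq hF).symm
  let e₂ := ((C \ F).equivFinOfCardEq hCF).symm
  let e₃ := ((Cᶜ).equivFinOfCardEq hr).symm
  let f : Fin k ⊕ (Fin b ⊕ Fin r) → V :=
    Sum.elim (fun i => e₁ i) (Sum.elim (fun i => e₂ i) (fun i => e₃ i))
  have m₁ : ∀ i, (e₁ i : V) ∈ F := fun i => (e₁ i).2
  have m₁' : ∀ i, (e₁ i : V) ∈ C := fun i => h.subset (m₁ i)
  have m₂ : ∀ i, (e₂ i : V) ∈ C := fun i => (Finset.mem_sdiff.mp (e₂ i).2).1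
  have m₂' : ∀ i, (e₂ i : V) ∉ F := fun i => (Finset.mem_sdiff.mp (e₂ i).2).2
  have m₃ : ∀ i, (e₃ i : V) ∉ C := fun i => Finset.mem_compl.mp (e₃ i).2
  have i₁ : ∀ i j, (e₁ i : V) = e₁ j ↔ i = j := fun i j => by
    rw [Subtype.coe_inj, e₁.apply_eq_iff_eq]
  have i₂ : ∀ i j, (e₂ i : V) = e₂ j ↔ i = j := fun i j => by
    rw [Subtype.coe_inj, e₂.apply_eq_iff_eq]
  have i₃ : ∀ i j, (e₃ i : V) = e₃ j ↔ i = j := fun i j => by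
    rw [Subtype.coe_inj, e₃.apply_eq_iff_eq]
  have hinj : Function.Injective f := by
    rintro (i | i | i) (j | j | j) hij
    · exact congrArg _ ((i₁ i j).mp hij)
    · exact absurd ((show (e₁ i : V) = e₂ j from hij) ▸ m₁ i) (m₂' j)
    · exact absurd ((show (e₁ i : V) = e₃ j from hij) ▸ m₁' i) (m₃ j)
    · exact absurd ((show (e₂ i : V) = e₁ j from hij) ▸ m₁ j) (m₂' i)
    · exact congrArg (fun x => Sum.inr (Sum.inl x)) ((i₂ i j).mp hij)
    · exact absurd ((show (e₂ i : V) = e₃ j from hij) ▸ m₂ i) (m₃ j)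
    · exact absurd ((show (e₃ i : V) = e₁ j from hij) ▸ m₁' j) (m₃ i)
    · exact absurd ((show (e₃ i : V) = e₂ j from hij) ▸ m₂ j) (m₃ i)
    · exact congrArg (fun x => Sum.inr (Sum.inr x)) ((i₃ i j).mp hij)
  have hbij : Function.Bijective f := by
    rw [Fintype.bijective_iff_injective_and_card]
    refine ⟨hinj, ?_⟩
    have := Finset.card_add_card_compl C
    simp only [Fintype.card_sum, Fintype.card_fin]
    omega
  have hclique : ∀ u ∈ C, ∀ v ∈ C, H.Adj u v ↔ u ≠ v := fun u hu v hv =>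
    ⟨fun h => h.ne, h.isClique hu hv⟩
  have hindep : ∀ u ∉ C, ∀ v ∉ C, ¬ H.Adj u v := by
    intro u hu v hv huv
    have h1 := h.card_add_card_sdiff hu
    have h2 : v ∈ H.neighborFinset u \ C := by simp [huv, hv]
    have := Finset.card_pos.mpr ⟨v, h2⟩
    omega
  refine ⟨RelIso.symm ⟨Equiv.ofBijective f hbij, ?_⟩⟩
  rintro (i | i | i) (j | j | j) <;>
    simp only [Equiv.ofBijective_apply, f, Sum.elim_inl, Sum.elim_inr, joinCliqueIndep, join,
      sup_adj, completeBipartiteGraph_adj, sum_adj, completeGraph, emptyGraph, top_adj, bot_adj,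
      Sum.isLeft_inl, Sum.isRight_inr, Sum.isLeft_inr, Sum.isRight_inl]
  · simp [hclique _ (m₁' i) _ (m₁' j), i₁]
  · have : (e₁ i : V) ≠ e₂ j := fun e => m₂' j (e ▸ m₁ i)
    simp [hclique _ (m₁' i) _ (m₂ j), this]
  · simp [H.adj_comm (e₁ i), h.adj_iff _ (m₃ j) _ (m₁' i), m₁ i]
  · have : (e₂ i : V) ≠ e₁ j := fun e => m₂' i (e ▸ m₁ j)
    simp [hclique _ (m₂ i) _ (m₁' j), this]
  · simp [hclique _ (m₂ i) _ (m₂ j), i₂]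
  · simp [H.adj_comm (e₂ i), h.adj_iff _ (m₃ j) _ (m₂ i), m₂' i]
  · simp [h.adj_iff _ (m₃ i) _ (m₁' j), m₁ j]
  · simp [h.adj_iff _ (m₃ i) _ (m₂ j), m₂' j]
  · simp [hindep _ (m₃ i) _ (m₃ j)]

/-- The argument shared by both parts: `s = 0` for Hamilton cycles, `s = 1` for Hamilton paths. The
graph `H` stands for an edge-maximal supergraph of `G` without a Hamilton cycle, resp. path. -/
theorem nonempty_iso_of_spectralRadius_le {G H : SimpleGraph V} [DecidableRel G.Adj]
    [DecidableRel H.Adj] {n k s : ℕ} (hs : s ≤ 1) (hks : 1 ≤ k + s) (hcard : Fintype.card V = n)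
    (hn : 6 * k + 5 + 5 * s ≤ n) (hn2 : k ^ 2 + (6 + s) * k + 4 + 4 * s ≤ 2 * n)
    (hk : ∀ v, k ≤ G.degree v)
    (hρ : (joinCliqueIndep k (n - 2 * k - s) (k + s)).spectralRadius ≤ G.spectralRadius)
    (hGH : G ≤ H)
    (hcl : ∀ u v, u ≠ v → ¬ H.Adj u v → H.degree u + H.degree v + 1 + s ≤ n) (hne : H ≠ ⊤) :
    Nonempty (G ≃g joinCliqueIndep k (n - 2 * k - s) (k + s)) := by
  have hV : Nonempty V := Fintype.card_pos_iff.mp (by omega)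
  set b := n - 2 * k - s with hb
  have hnb : (n : ℝ) = 2 * k + s + b := by
    have : n = 2 * k + s + b := by omega
    exact_mod_cast this
  have hdeg : ∀ v, G.degree v ≤ H.degree v := fun v => degree_le_of_le hGH
  have hk0 : (0 : ℝ) ≤ k := by positivity
  have hs0 : (0 : ℝ) ≤ s := by positivity
  have hn' : 6 * (k : ℝ) + 5 + 5 * s ≤ n := by exact_mod_cast hn
  have hn2' : (k : ℝ) ^ 2 + (6 + s) * k + 4 + 4 * s ≤ 2 * n := by exact_mod_cast hn2
  -- a lower bound on the spectral radius gives many edges, hence the clique structure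
  have hsplit : (k : ℝ) + b - 1 ≤ G.spectralRadius →
      ((k : ℝ) + b - 1 < G.spectralRadius ∨
        (k : ℝ) ^ 2 + (6 + s) * k + 4 + 4 * s < 2 * n) →
      ∃ C F : Finset V, H.IsCliqueSplit k C F ∧ C.card + k + s = n := by
    intro hle hor
    refine H.exists_isCliqueSplit hs hcard hn (fun v => (hk v).trans (hdeg v)) hcl hne ?_
    obtain ⟨u, hu, hGu⟩ := G.exists_eigenvector_spectralRadius
    have hM : (k : ℝ) + b - 1 = n - k - s - 1 := by rw [hnb]; ring
    rw [hM] at hle hor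
    have h1 := G.sq_sub_le_of_eigenvector hk (by linarith) hu hGu
    have h2 : ∑ v, (G.degree v : ℝ) ≤ ∑ v, (H.degree v : ℝ) :=
      Finset.sum_le_sum fun v _ => by exact_mod_cast hdeg v
    rw [hcard] at h1
    refine lt_of_lt_of_le ?_ h2
    set μ := G.spectralRadius
    rcases hor with hlt | hlt
    · have : 0 < (μ - (n - k - s - 1)) * (μ + (n - k - s - 1) - (k - 1)) :=
        mul_pos (by linarith) (by linarith)
      linarith
    · have : 0 ≤ (μ - (n - k - s - 1)) * (μ + (n - k - s - 1) - (k - 1)) :=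
        mul_nonneg (by linarith) (by linarith)
      linarith
  rcases Nat.eq_zero_or_pos k with rfl | hk1
  -- `K_0 ∨ (K_{n-1} + K_1)` is disconnected: no dominating vertex, and its radius is exactly `n - 2`
  · obtain rfl : s = 1 := by omega
    have h1 := (le_spectralRadius_joinCliqueIndep_zero (r := 0 + 1) (by omega : 1 ≤ b)).trans hρ
    obtain ⟨C, F, hCF, hC⟩ := hsplit (by simpa using h1)
      (Or.inr (by push_cast at hn' ⊢; linarith))
    have hCc := Finset.card_add_card_compl C
    obtain ⟨v, hv⟩ : Cᶜ.Nonempty := Finset.card_pos.mp (by omega)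
    have hF0 := hCF.card_add_card_sdiff (Finset.mem_compl.mp hv)
    obtain rfl : F = ∅ := Finset.card_eq_zero.mp (by omega)
    have hCb : C.card = b := by omega
    obtain rfl : G = H := hCF.eq_of_zero hGH (by omega) (by rw [hCb]; exact h1)
    convert hCF.nonempty_iso (b := b) (r := 0 + 1) rfl (by omega) (by omega)
  · obtain ⟨t, ht, hroot⟩ := exists_root_of_quotient_equation (k := k) (r := k + s) (c := k + b)
      (by exact_mod_cast hk1) (by exact_mod_cast hks) (by norm_cast; omega)
    have h1 := (add_sub_one_le_spectralRadius_joinCliqueIndep (k := k) (b := b) (r := k + s) hk1 ht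
      (by push_cast; exact hroot)).trans hρ
    obtain ⟨C, F, hCF, hC⟩ := hsplit (by linarith) (Or.inl (by linarith))
    have hCc := Finset.card_add_card_compl C
    have hCb : C.card = k + b := by omega
    have hCr : Cᶜ.card = k + s := by omega
    have hF : F.Nonempty := by
      rw [Finset.nonempty_iff_ne_empty]
      rintro rfl
      have := hCF.spectralRadius_le_of_empty hGH (by omega)
      rw [hCb] at this
      push_cast at this
      linarith
    obtain ⟨rfl, hFk⟩ := hCF.eq_and_card_eq hGH hF (Finset.card_pos.mp (by omega)) (by omega) ht
      (by rw [hCb, hCr]; push_cast; exact hroot) (by rw [hCb]; push_cast; exact h1)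
    convert hCF.nonempty_iso hFk hCb hCr

end SimpleGraph

open SimpleGraph

theorem theorem1p5 {V : Type*} [Fintype V] [DecidableEq V] (G : SimpleGraph V)
    [DecidableRel G.Adj] (n k : ℕ) (hn : Fintype.card V = n) :
    (k ≤ G.minDegree →
      max (6 * (k : ℝ) + 10) (((k : ℝ) ^ 2 + 7 * k + 8) / 2) ≤ n →
      (SimpleGraph.graphNBar n k).spectralRadius ≤ G.spectralRadius →
      (G.IsTraceable ↔ ¬ Nonempty (G ≃g SimpleGraph.graphNBar n k))) ∧
    (1 ≤ k → k ≤ G.minDegree →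
      max (6 * (k : ℝ) + 5) (((k : ℝ) ^ 2 + 6 * k + 4) / 2) ≤ n →
      (SimpleGraph.graphN n k).spectralRadius ≤ G.spectralRadius →
      (G.IsHamiltonian ↔ ¬ Nonempty (G ≃g SimpleGraph.graphN n k))) := by
  classical
  constructor
  · intro hk hmax hρ
    obtain ⟨hn1, hn2⟩ := max_le_iff.mp hmax
    have hn1 : 6 * k + 10 ≤ n := by exact_mod_cast hn1
    have hn2 : k ^ 2 + 7 * k + 8 ≤ 2 * n := by
      have : (k : ℝ) ^ 2 + 7 * k + 8 ≤ 2 * n := by linarith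
      exact_mod_cast this
    rw [G.isTraceable_iff_exists_isPathSeq hn (by omega)]
    constructor
    · rintro ⟨q, hq⟩ ⟨e⟩
      exact not_isPathSeq_joinCliqueIndep (a := k) (b := n - 2 * k - 1) (r := k + 1) (by omega)
        le_rfl (by omega) _ (hq.map e)
    · intro hiso
      by_contra hG
      obtain ⟨H, hGH, hH⟩ := Finite.exists_le_maximal
        (p := fun H : SimpleGraph V => ¬ ∃ q, H.IsPathSeq n q) hG
      refine hiso (nonempty_iso_of_spectralRadius_le (H := H) le_rfl (by omega) hn (by omega)
        (by linarith) (fun v => hk.trans (G.minDegree_le_degree v)) hρ hGH ?_ ?_)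
      · intro u v huv hadj
        by_contra! hdeg
        have hedge : ∃ q, (H ⊔ edge u v).IsPathSeq n q := by
          by_contra hno
          exact hadj (hH.le_of_ge hno le_sup_left (Or.inr ((edge_adj u v u v).mpr ⟨by simp, huv⟩)))
        obtain ⟨q, hq⟩ := (exists_isPathSeq_iff_cone _ hn (by omega)).mp hedge
        refine hH.prop ((exists_isPathSeq_iff_cone _ hn (by omega)).mpr
          ((hq.mono (H.cone_sup_edge_le u v)).of_sup_edge (by simp [hn]) (by omega) ?_))
        rw [degree_cone_some, degree_cone_some]
        omega
      · rintro rfl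
        obtain ⟨q, hq⟩ := exists_isCycleSeq_top hn (by omega)
        exact hH.prop ⟨q, hq.toIsPathSeq⟩
  · intro hk1 hk hmax hρ
    obtain ⟨hn1, hn2⟩ := max_le_iff.mp hmax
    have hn1 : 6 * k + 5 ≤ n := by exact_mod_cast hn1
    have hn2 : k ^ 2 + 6 * k + 4 ≤ 2 * n := by
      have : (k : ℝ) ^ 2 + 6 * k + 4 ≤ 2 * n := by linarith
      exact_mod_cast this
    rw [G.isHamiltonian_iff_exists_isCycleSeq hn (by omega)]
    constructor
    · rintro ⟨q, hq⟩ ⟨e⟩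
      exact not_isCycleSeq_joinCliqueIndep (a := k) (b := n - 2 * k) (r := k) hk1 (by omega)
        le_rfl (by omega) _ (hq.map e)
    · intro hiso
      by_contra hG
      obtain ⟨H, hGH, hH⟩ := Finite.exists_le_maximal
        (p := fun H : SimpleGraph V => ¬ ∃ q, H.IsCycleSeq n q) hG
      refine hiso (nonempty_iso_of_spectralRadius_le (H := H) (s := 0) (by omega) hk1 hn (by omega)
        (by linarith) (fun v => hk.trans (G.minDegree_le_degree v)) hρ hGH ?_ ?_)
      · intro u v huv hadj
        by_contra! hdeg
        have hedge : ∃ q, (H ⊔ edge u v).IsCycleSeq n q := by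
          by_contra hno
          exact hadj (hH.le_of_ge hno le_sup_left (Or.inr ((edge_adj u v u v).mpr ⟨by simp, huv⟩)))
        obtain ⟨q, hq⟩ := hedge
        exact hH.prop (hq.of_sup_edge hn (by omega) (by omega))
      · rintro rfl
        exact hH.prop (exists_isCycleSeq_top hn (by omega))
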